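/- Fix an arrival rate $\lambda>0$, a horizon $T>0$, an efficiency $q>0$ and a constant $\kappa\in\mathbb R$. Let $X\ge 0$ have density $f$ and distribution function $F$, and put $D=\{x: 0<F(x)<1\}$. Assume that $f$ is continuous and positive on $D$ and that the virtual valuation $\psi(x)=x-\frac{1-F(x)}{f(x)}$ is strictly increasing on $D$. For $0\le t\le T$ and a measurable threshold function $y\ge 0$ on $[t,T]$ put $\hat\lambda(s)=\lambda(1-F(y(s)))$, $H(s)=\int_t^s\hat\lambda(u)\,du$, and for $N\ge1$ $$\mathcal R_N(t,y)=\sum_{n=1}^{N} q\int_t^T y(s)\,\hat\lambda(s)e^{-H(s)}\frac{H(s)^{n-1}}{(n-1)!}\,ds+\kappa,\qquad J_N(t,s)=\frac{\sum_{n=1}^{N}\frac{1}{(n-1)!}\left(H(s)^{n-1}-(n-1)H(s)^{n-2}\right)}{\sum_{n=1}^{N}\frac{1}{(n-1)!}H(s)^{n-1}}.$$ Here $N$ is the number of available machines at time $t$, a task of complexity $x$ arriving at time $s$ is allocated if and only if $x\ge y(s)$, $\mathcal R_N(t,y)$ is the expected revenue, and $y$ is called optimal for $(N,t)$ if it maximizes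 $\mathcal R_N(t,\cdot)$ over all measurable nonnegative thresholds on $[t,T]$. As $N\to\infty$: 1. $J_N(t,s)\to0$, uniformly in $0\le t\le s\le T$ and in the threshold function $y$. 2. The equation $c=\frac{1-F(c)}{f(c)}$ has at most one solution $c\in D$, and it has one if $\mathbb E[X]<\infty$ and $F(x)>0$ for all $x>0$. 3. Let $c\in D$ be this solution. Then the optimal thresholds converge to the constant $c$: for every $\varepsilon>0$ there is $N_0$ such that for all $N\ge N_0$, all $t\in[0,T)$ and all $y$ optimal for $(N,t)$, $|y(s)-c|<\varepsilon$ for almost every $s\in[t,T]$, and for every $s\in[t,T]$ if $y$ is continuous on $[t,T]$. Likewise, the $D$-valued measurable solutions $y$ on $[0,T]$ of $$y(t)=\frac{1-F(y(t))}{f(y(t))}+\lambda\int_t^T\frac{(1-F(y(s)))^2}{f(y(s))}J_N(t,s)\,ds,\qquad t\in[0,T],$$ converge to $c$ uniformly on $[0,T]$. Moreover the constant threshold $c$ is asymptotically optimal: for every $\varepsilon>0$ and all large $N$, $\mathcal R_N(t,y)\le\mathcal R_N(t,c)+\varepsilon$ for all $t\in[0,T]$ and all measurable $y\ge0$ on $[t,T]$.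 4. The allocation reduces to the virtual-valuation (Myerson) rule: for $x\in D$, $x\ge c$ if and only if $\psi(x)\ge0$; and for every $x\in D$ with $x\ne c$ there is $N_0$ such that for all $N\ge N_0$, all $t\in[0,T)$ and all $y$ optimal for $(N,t)$, for almost every $s\in[t,T]$ a task of complexity $x$ arriving at time $s$ is allocated if and only if $\psi(x)\ge0$. -/

import Mathlib

open MeasureTheory ProbabilityTheory Filter Set Topology

noncomputable section

namespace VMAlloc

/-- Intensity at time `s` of the arrivals that qualify under the threshold function `y`,
when requests arrive at rate `lam` and complexities have distribution function `F`. -/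
def qualIntensity (lam : ℝ) (F : ℝ → ℝ) (y : ℝ → ℝ) (s : ℝ) : ℝ :=
  lam * (1 - F (y s))

/-- Cumulative intensity `H(s) = ∫_t^s` of the qualifying arrivals. -/
def cumIntensity (lam : ℝ) (F : ℝ → ℝ) (y : ℝ → ℝ) (t s : ℝ) : ℝ :=
  ∫ u in t..s, qualIntensity lam F y u

/-- Density at `s` of the waiting time, from time `t`, until the `n`-th qualifying arrival
(`n ≥ 1`). -/
def waitingDensity (lam : ℝ) (F : ℝ → ℝ) (y : ℝ → ℝ) (t : ℝ) (n : ℕ) (s : ℝ) : ℝ :=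
  qualIntensity lam F y s * Real.exp (-cumIntensity lam F y t s) *
    (cumIntensity lam F y t s ^ (n - 1) / (n - 1).factorial)

/-- Expected revenue from time `t` on, with `N` identical machines of efficiency `q`, horizon `T`,
threshold function `y`, and a constant `κ` that does not depend on the allocation. -/
def revenue (lam q κ T : ℝ) (F : ℝ → ℝ) (N : ℕ) (t : ℝ) (y : ℝ → ℝ) : ℝ :=
  (∑ n ∈ Finset.Icc 1 N, q * ∫ s in t..T, y s * waitingDensity lam F y t n s) + κ

/-- Threshold functions on `[t, T]`; values outside `[t, T]` play no role. -/
def Admissible (t T : ℝ) (y : ℝ → ℝ) : Prop :=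
  Measurable y ∧ ∀ s ∈ Icc t T, 0 ≤ y s

/-- `y` maximizes the expected revenue from time `t` on, given `N` available machines. -/
def IsOptimalThreshold (lam q κ T : ℝ) (F : ℝ → ℝ) (N : ℕ) (t : ℝ) (y : ℝ → ℝ) : Prop :=
  Admissible t T y ∧
    ∀ z, Admissible t T z → revenue lam q κ T F N t z ≤ revenue lam q κ T F N t y

/-- The kernel `J_N(t, s)` belonging to the threshold function `y`. For `n = 1` the second term has
coefficient `n - 1 = 0`, so the truncated exponent `n - 2` is harmless. -/
def kernelJ (lam : ℝ) (F : ℝ → ℝ) (y : ℝ → ℝ) (N : ℕ) (t s : ℝ) : ℝ :=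
  (∑ n ∈ Finset.Icc 1 N, (1 / ((n - 1).factorial : ℝ)) *
      (cumIntensity lam F y t s ^ (n - 1) -
        ((n : ℝ) - 1) * cumIntensity lam F y t s ^ (n - 2))) /
    (∑ n ∈ Finset.Icc 1 N, (1 / ((n - 1).factorial : ℝ)) * cumIntensity lam F y t s ^ (n - 1))

/-- The points where the distribution function lies strictly between 0 and 1. -/
def supportInterior (F : ℝ → ℝ) : Set ℝ := {x | 0 < F x ∧ F x < 1}

/-- Virtual valuation of type `x`. -/
def virtualValuation (F f : ℝ → ℝ) (x : ℝ) : ℝ := x - (1 - F x) / f x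

/-- `c` solves `c = (1 - F c) / f c`, inside the support. -/
def IsMyersonThreshold (F f : ℝ → ℝ) (c : ℝ) : Prop :=
  c ∈ supportInterior F ∧ c = (1 - F c) / f c

/-- `y` solves the integral equation of the threshold for `N` machines at all times of `[0, T]`. -/
def SolvesThresholdEquation (lam T : ℝ) (F f : ℝ → ℝ) (N : ℕ) (y : ℝ → ℝ) : Prop :=
  Admissible 0 T y ∧ (∀ t ∈ Icc 0 T, y t ∈ supportInterior F) ∧
    ∀ t ∈ Icc 0 T, y t = (1 - F (y t)) / f (y t) +
      lam * ∫ s in t..T, (1 - F (y s)) ^ 2 / f (y s) * kernelJ lam F y N t s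

end VMAlloc

end

open MeasureTheory ProbabilityTheory Filter Set Topology

noncomputable section

namespace VMAlloc

/-! Write `G(x) = x(1 - F(x))` and let `P_N(h)` be the probability that a Poisson variable of mean
`h` is below `N`. Summing the waiting-time densities turns the revenue into `qλ ∫ G(y(s)) P_N(H(s))
ds + κ` (`revenue_eq`). The threshold thus acts through the current rate `G` and through the
depletion factor `P_N`. Since `0 ≤ H ≤ λT`, a telescoping derivative makes `P_{N+1}` Lipschitz with
constant `η = (λT)^N / N!`, and `η → 0`. The same quantity bounds `J_{N+1}`. Nothing depends on `t`
or `y`, hence the uniformity.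

With depletion negligible, `G` should be maximized pointwise. As `G' = -fψ` on the support and `ψ`
increases, `c` is the well-separated maximizer (`exists_revenueRate_gap`). If `y` is at distance at
least `ε` from `c` on a set `A`, resetting it to `c` there gains at least a constant times `|A|`,
while the extra depletion costs `O(η |A|)`. For large `N` an optimal `y` must have `|A| = 0`
(`revenue_piecewise_gain`).

For the integral equation, `J_N ≥ 0` forces `ψ(y) ≥ 0`, which bounds the integrand by `G(c) η`.
Hence `0 ≤ ψ(y(t)) ≤ λ T G(c) η`, and monotonicity of `ψ` pins `y(t)` to `c`. -/

/-- Probability that a Poisson variable of mean `h` is less than `N`. -/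
def poissonLT (N : ℕ) (h : ℝ) : ℝ :=
  Real.exp (-h) * ∑ k ∈ Finset.range N, h ^ k / (k.factorial : ℝ)

/-- Revenue rate of the constant threshold `x`, per unit of arrival rate. -/
def revenueRate (F : ℝ → ℝ) (x : ℝ) : ℝ := x * (1 - F x)

/-! ### Poisson probabilities as functions of the mean -/

lemma sum_Icc_one_eq_sum_range (N : ℕ) (g : ℕ → ℝ) :
    ∑ n ∈ Finset.Icc 1 N, g n = ∑ k ∈ Finset.range N, g (k + 1) := by
  induction N with
  | zero => simp
  | succ m ih => rw [Finset.sum_Icc_succ_top (by omega), ih, Finset.sum_range_succ]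

/-- The derivative of `e^{-h} h^k / k!` is the preceding Poisson weight minus this one, so the sum
telescopes to its last term. -/
lemma hasDerivAt_poissonLT (N : ℕ) (h : ℝ) :
    HasDerivAt (poissonLT (N + 1)) (-(Real.exp (-h) * (h ^ N / (N.factorial : ℝ)))) h := by
  have he : HasDerivAt (fun h : ℝ => Real.exp (-h)) (-Real.exp (-h)) h := by
    simpa using (hasDerivAt_neg h).exp
  induction N with
  | zero =>
    have : poissonLT (0 + 1) = fun h : ℝ => Real.exp (-h) := by
      funext h; simp [poissonLT]
    rw [this]; simpa using he
  | succ m ih =>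
    have hp : poissonLT (m + 1 + 1) = fun h : ℝ => poissonLT (m + 1) h +
        Real.exp (-h) * (h ^ (m + 1) / ((m + 1).factorial : ℝ)) := by
      funext h; simp only [poissonLT]; rw [Finset.sum_range_succ _ (m + 1)]; ring
    rw [hp]
    have hd := ih.add (he.mul ((hasDerivAt_pow (m + 1) h).div_const ((m + 1).factorial : ℝ)))
    refine hd.congr_deriv ?_
    have h1 : ((m + 1).factorial : ℝ) = (m + 1) * m.factorial := by
      rw [Nat.factorial_succ]; push_cast; ring
    have h2 : (m.factorial : ℝ) ≠ 0 := by positivity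
    have h3 : (m + 1 : ℝ) ≠ 0 := by positivity
    rw [h1]
    simp only [Nat.add_sub_cancel]
    push_cast
    field_simp
    ring

lemma continuous_poissonLT (N : ℕ) : Continuous (poissonLT N) := by
  unfold poissonLT; fun_prop

lemma abs_poissonLT_sub_le (N : ℕ) {L a b : ℝ} (ha : a ∈ Icc 0 L) (hb : b ∈ Icc 0 L) :
    |poissonLT (N + 1) b - poissonLT (N + 1) a| ≤ L ^ N / (N.factorial : ℝ) * |b - a| := by
  refine (convex_Icc (0 : ℝ) L).norm_image_sub_le_of_norm_hasDerivWithin_le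
    (fun x _ => (hasDerivAt_poissonLT N x).hasDerivWithinAt) (fun x hx => ?_) ha hb
  have hx0 : 0 ≤ x := hx.1
  rw [norm_neg, Real.norm_of_nonneg (by positivity)]
  calc Real.exp (-x) * (x ^ N / (N.factorial : ℝ))
      ≤ 1 * (L ^ N / (N.factorial : ℝ)) := by
        gcongr
        · exact Real.exp_le_one_iff.2 (by linarith)
        · exact hx.2
    _ = _ := one_mul _

lemma poissonLT_succ_zero (N : ℕ) : poissonLT (N + 1) 0 = 1 := by
  simp [poissonLT, Finset.sum_range_succ']

lemma poissonLT_nonneg (N : ℕ) {h : ℝ} (hh : 0 ≤ h) : 0 ≤ poissonLT N h := by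
  unfold poissonLT; positivity

lemma poissonLT_le_one (N : ℕ) {h : ℝ} (hh : 0 ≤ h) : poissonLT N h ≤ 1 := by
  unfold poissonLT
  calc _ ≤ Real.exp (-h) * Real.exp h := by
        gcongr; exact Real.sum_le_exp_of_nonneg hh N
    _ = 1 := by rw [← Real.exp_add]; simp

lemma one_le_sum_range_succ (N : ℕ) {h : ℝ} (hh : 0 ≤ h) :
    1 ≤ ∑ k ∈ Finset.range (N + 1), h ^ k / (k.factorial : ℝ) := by
  rw [Finset.sum_range_succ']
  have : 0 ≤ ∑ k ∈ Finset.range N, h ^ (k + 1) / ((k + 1).factorial : ℝ) := by positivity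
  simpa using this

/-- The term `k = 0` alone suffices. This bound, free of `N`, keeps the depletion factor from
cancelling a gain in the revenue rate. -/
lemma exp_neg_le_poissonLT (N : ℕ) {L h : ℝ} (hh : 0 ≤ h) (hL : h ≤ L) :
    Real.exp (-L) ≤ poissonLT (N + 1) h := by
  unfold poissonLT
  calc Real.exp (-L) = Real.exp (-L) * 1 := (mul_one _).symm
    _ ≤ _ := by
        gcongr
        exact one_le_sum_range_succ N hh

/-! ### Revenue and kernel for arbitrary threshold functions -/

section Thresholds

variable {lam t T : ℝ} {y F : ℝ → ℝ}

lemma qualIntensity_mem_Icc (hlam : 0 ≤ lam) (hF : ∀ x, F x ∈ Icc (0 : ℝ) 1) (y : ℝ → ℝ) (s : ℝ) :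
    qualIntensity lam F y s ∈ Icc 0 lam := by
  obtain ⟨h0, h1⟩ := hF (y s)
  unfold qualIntensity
  constructor <;> nlinarith

lemma measurable_qualIntensity (hFm : Measurable F) (hy : Measurable y) :
    Measurable (qualIntensity lam F y) := by
  unfold qualIntensity
  exact (measurable_const.sub (hFm.comp hy)).const_mul _

lemma intervalIntegrable_of_measurable_of_abs_le {g : ℝ → ℝ} {C a b : ℝ} (hg : Measurable g)
    (hC : ∀ s ∈ uIoc a b, |g s| ≤ C) : IntervalIntegrable g volume a b := by
  rw [intervalIntegrable_iff]
  refine Measure.integrableOn_of_bounded (M := C) ?_ hg.aestronglyMeasurable ?_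
  · simp [uIoc]
  · exact (ae_restrict_iff' measurableSet_uIoc).2 (Eventually.of_forall hC)

lemma intervalIntegrable_qualIntensity (hlam : 0 ≤ lam) (hF : ∀ x, F x ∈ Icc (0 : ℝ) 1)
    (hFm : Measurable F) (hy : Measurable y) (a b : ℝ) :
    IntervalIntegrable (qualIntensity lam F y) volume a b :=
  intervalIntegrable_of_measurable_of_abs_le (measurable_qualIntensity hFm hy) (C := lam)
    fun s _ => by
      have := qualIntensity_mem_Icc hlam hF y s
      rw [abs_of_nonneg this.1]; exact this.2

lemma continuous_cumIntensity (hlam : 0 ≤ lam) (hF : ∀ x, F x ∈ Icc (0 : ℝ) 1)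
    (hFm : Measurable F) (hy : Measurable y) (t : ℝ) : Continuous (cumIntensity lam F y t) :=
  intervalIntegral.continuous_primitive (intervalIntegrable_qualIntensity hlam hF hFm hy) t

lemma cumIntensity_mem_Icc (hlam : 0 ≤ lam) (hF : ∀ x, F x ∈ Icc (0 : ℝ) 1)
    (ht : 0 ≤ t) {s : ℝ} (hts : t ≤ s) (hs : s ≤ T) (y : ℝ → ℝ) :
    cumIntensity lam F y t s ∈ Icc 0 (lam * T) := by
  have h0 : 0 ≤ cumIntensity lam F y t s :=
    intervalIntegral.integral_nonneg hts fun u _ => (qualIntensity_mem_Icc hlam hF y u).1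
  refine ⟨h0, ?_⟩
  have := intervalIntegral.norm_integral_le_of_norm_le_const (a := t) (b := s)
    (f := qualIntensity lam F y) (C := lam) fun u _ => by
      have := qualIntensity_mem_Icc hlam hF y u
      rw [Real.norm_of_nonneg this.1]; exact this.2
  rw [abs_of_nonneg (by linarith)] at this
  calc cumIntensity lam F y t s ≤ lam * (s - t) := (le_abs_self _).trans this
    _ ≤ lam * T := by gcongr; linarith

/-- The numerator telescopes: each summand is a term of the exponential series minus its
predecessor. -/
lemma kernelJ_succ_eq (lam : ℝ) (F y : ℝ → ℝ) (N : ℕ) (t s : ℝ) :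
    kernelJ lam F y (N + 1) t s = (cumIntensity lam F y t s ^ N / (N.factorial : ℝ)) /
      ∑ k ∈ Finset.range (N + 1), cumIntensity lam F y t s ^ k / (k.factorial : ℝ) := by
  unfold kernelJ
  set h := cumIntensity lam F y t s
  rw [sum_Icc_one_eq_sum_range, sum_Icc_one_eq_sum_range]
  congr 1
  · induction N with
    | zero => simp
    | succ m ih =>
      rw [Finset.sum_range_succ, ih]
      have h1 : ((m + 1).factorial : ℝ) = (m + 1) * m.factorial := by
        rw [Nat.factorial_succ]; push_cast; ring
      have h2 : (m.factorial : ℝ) ≠ 0 := by positivity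
      have h3 : (m + 1 : ℝ) ≠ 0 := by positivity
      simp only [Nat.add_sub_cancel, show m + 1 + 1 - 2 = m by omega]
      rw [h1]
      push_cast
      field_simp
      ring
  · refine Finset.sum_congr rfl fun k _ => ?_
    simp only [Nat.add_sub_cancel]
    ring

lemma kernelJ_succ_mem_Icc (hlam : 0 ≤ lam) (hF : ∀ x, F x ∈ Icc (0 : ℝ) 1)
    (ht : 0 ≤ t) {s : ℝ} (hts : t ≤ s) (hs : s ≤ T) (y : ℝ → ℝ) (N : ℕ) :
    kernelJ lam F y (N + 1) t s ∈ Icc 0 ((lam * T) ^ N / (N.factorial : ℝ)) := by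
  obtain ⟨h0, h1⟩ := cumIntensity_mem_Icc hlam hF ht hts hs y
  rw [kernelJ_succ_eq]
  refine ⟨by positivity, ?_⟩
  calc _ ≤ cumIntensity lam F y t s ^ N / (N.factorial : ℝ) :=
        div_le_self (by positivity) (one_le_sum_range_succ N h0)
    _ ≤ _ := by gcongr

lemma measurable_revenueRate_comp (hFm : Measurable F) (hy : Measurable y) :
    Measurable fun s => revenueRate F (y s) := by
  unfold revenueRate
  exact hy.mul (measurable_const.sub (hFm.comp hy))

lemma intervalIntegrable_revenueRate_mul {M : ℝ} (hlam : 0 ≤ lam)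
    (hF : ∀ x, F x ∈ Icc (0 : ℝ) 1) (hFm : Measurable F)
    (hM : ∀ x, 0 ≤ x → revenueRate F x ≤ M) (htT : t ≤ T)
    (hy : Admissible t T y) {g : ℝ → ℝ} (hg : Continuous g) :
    IntervalIntegrable (fun s => revenueRate F (y s) * g (cumIntensity lam F y t s))
      volume t T := by
  refine IntervalIntegrable.mul_continuousOn ?_
    (hg.comp (continuous_cumIntensity hlam hF hFm hy.1 t)).continuousOn
  refine intervalIntegrable_of_measurable_of_abs_le (measurable_revenueRate_comp hFm hy.1)
    (C := M) fun s hs => ?_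
  rw [uIoc_of_le htT] at hs
  have hys := hy.2 s (Ioc_subset_Icc_self hs)
  rw [abs_of_nonneg (show 0 ≤ revenueRate F (y s) from
    mul_nonneg hys (by linarith [(hF (y s)).2]))]
  exact hM _ hys

lemma revenue_eq {M : ℝ} (q κ : ℝ) (hlam : 0 ≤ lam)
    (hF : ∀ x, F x ∈ Icc (0 : ℝ) 1) (hFm : Measurable F)
    (hM : ∀ x, 0 ≤ x → revenueRate F x ≤ M) (htT : t ≤ T) (hy : Admissible t T y) (N : ℕ) :
    revenue lam q κ T F N t y = q * lam *
      (∫ s in t..T, revenueRate F (y s) * poissonLT N (cumIntensity lam F y t s)) + κ := by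
  unfold revenue
  rw [sum_Icc_one_eq_sum_range, ← Finset.mul_sum, mul_assoc]
  congr 2
  rw [← intervalIntegral.integral_finsetSum, ← intervalIntegral.integral_const_mul]
  · refine intervalIntegral.integral_congr fun s _ => ?_
    simp only [waitingDensity, qualIntensity, revenueRate, poissonLT, Nat.add_sub_cancel,
      Finset.mul_sum]
    refine Finset.sum_congr rfl fun k _ => ?_
    ring
  · intro k _
    have := (intervalIntegrable_revenueRate_mul (lam := lam) hlam hF hFm hM htT hy
      (g := fun h => Real.exp (-h) * (h ^ k / (k.factorial : ℝ))) (by fun_prop)).const_mul lam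
    refine this.congr fun s _ => ?_
    simp only [waitingDensity, qualIntensity, revenueRate, Nat.add_sub_cancel]
    ring

/-- Resetting the threshold to `c` on a set `A` where this gains `δ` in the revenue rate changes the
revenue by at least the gain on `A` minus the loss caused by faster exhaustion of the machines. -/
lemma revenue_piecewise_gain {M δ q κ c : ℝ} {N : ℕ} (hlam : 0 ≤ lam) (hq : 0 ≤ q)
    (hF : ∀ x, F x ∈ Icc (0 : ℝ) 1) (hFm : Measurable F)
    (hM : ∀ x, 0 ≤ x → revenueRate F x ≤ M) (ht : 0 ≤ t) (htT : t ≤ T)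
    (hy : Admissible t T y) (hc : 0 ≤ c) {A : Set ℝ} [DecidablePred (· ∈ A)]
    (hA : MeasurableSet A) (hAT : A ⊆ Icc t T) (hδ0 : 0 ≤ δ)
    (hδ : ∀ s ∈ A, revenueRate F (y s) + δ ≤ revenueRate F c) :
    revenue lam q κ T F (N + 1) t y + q * lam * (volume.real A *
        (δ * Real.exp (-(lam * T)) - M * ((lam * T) ^ N / (N.factorial : ℝ)) * lam * T)) ≤
      revenue lam q κ T F (N + 1) t (A.piecewise (fun _ => c) y) := by
  set z := A.piecewise (fun _ => c) y with hz
  set η := (lam * T) ^ N / (N.factorial : ℝ) with hη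
  have hT : 0 ≤ T := ht.trans htT
  have hη0 : 0 ≤ η := by positivity
  have hM0 : 0 ≤ M := by simpa [revenueRate] using hM 0 le_rfl
  have hAfin : volume A ≠ ⊤ :=
    ((measure_mono hAT).trans_lt (by simp)).ne
  have hza : Admissible t T z := by
    refine ⟨Measurable.piecewise hA measurable_const hy.1, fun s hs => ?_⟩
    by_cases hsA : s ∈ A
    · rwa [hz, piecewise_eq_of_mem _ _ _ hsA]
    · rw [hz, piecewise_eq_of_notMem _ _ _ hsA]; exact hy.2 s hs
  have hind : Integrable (A.indicator fun _ => (1 : ℝ)) volume :=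
    (integrable_indicator_iff hA).2 (integrableOn_const hAfin)
  have hindI : ∫ s, A.indicator (fun _ => (1 : ℝ)) s = volume.real A := by
    rw [integral_indicator hA]; simp
  -- The two intensities lie in `[0, λ]` and differ only on `A`. The factor `|A|` is what makes the
  -- loss comparable with the gain.
  have hH : ∀ s ∈ Icc t T, |cumIntensity lam F z t s - cumIntensity lam F y t s| ≤
      lam * volume.real A := by
    intro s hs
    unfold cumIntensity
    rw [← intervalIntegral.integral_sub (intervalIntegrable_qualIntensity hlam hF hFm hza.1 _ _)
      (intervalIntegrable_qualIntensity hlam hF hFm hy.1 _ _), ← Real.norm_eq_abs]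
    calc _ ≤ ∫ u in t..s, lam * A.indicator (fun _ => (1 : ℝ)) u := by
          refine intervalIntegral.norm_integral_le_of_norm_le hs.1
            (Eventually.of_forall fun u _ => ?_) (hind.const_mul lam).intervalIntegrable
          by_cases huA : u ∈ A
          · have h1 := qualIntensity_mem_Icc hlam hF z u
            have h2 := qualIntensity_mem_Icc hlam hF y u
            rw [indicator_of_mem huA, mul_one, Real.norm_eq_abs, abs_le]
            constructor <;> linarith [h1.1, h1.2, h2.1, h2.2]
          · simp [qualIntensity, hz, huA]
      _ ≤ lam * ∫ u, A.indicator (fun _ => (1 : ℝ)) u := by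
          rw [intervalIntegral.integral_const_mul, intervalIntegral.integral_of_le hs.1]
          refine mul_le_mul_of_nonneg_left ?_ hlam
          exact setIntegral_le_integral hind
            (Eventually.of_forall fun u => indicator_nonneg (fun _ _ => zero_le_one) u)
      _ = _ := by rw [hindI]
  -- Split `G(z)P_z - G(y)P_y = (G(z) - G(y))P_z + G(y)(P_z - P_y)`: gain on `A`, then depletion
  -- loss.
  have hpt : ∀ s ∈ Icc t T,
      revenueRate F (y s) * poissonLT (N + 1) (cumIntensity lam F y t s) +
        (δ * Real.exp (-(lam * T)) * A.indicator (fun _ => (1 : ℝ)) s -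
          M * η * lam * volume.real A) ≤
      revenueRate F (z s) * poissonLT (N + 1) (cumIntensity lam F z t s) := by
    intro s hs
    have hHy := cumIntensity_mem_Icc hlam hF ht hs.1 hs.2 y
    have hHz := cumIntensity_mem_Icc hlam hF ht hs.1 hs.2 z
    have hL := (abs_poissonLT_sub_le N hHy hHz).trans
      (mul_le_mul_of_nonneg_left (hH s hs) hη0)
    have hPz := exp_neg_le_poissonLT N hHz.1 hHz.2
    have hPz0 := poissonLT_nonneg (N + 1) hHz.1
    have hGy0 : 0 ≤ revenueRate F (y s) :=
      mul_nonneg (hy.2 s hs) (by linarith [(hF (y s)).2])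
    have hGyM := hM _ (hy.2 s hs)
    set Pz := poissonLT (N + 1) (cumIntensity lam F z t s)
    set Py := poissonLT (N + 1) (cumIntensity lam F y t s)
    have hloss : -(M * (η * (lam * volume.real A))) ≤ revenueRate F (y s) * (Pz - Py) := by
      have := (abs_le.1 (show |revenueRate F (y s) * (Pz - Py)| ≤
        M * (η * (lam * volume.real A)) by
          rw [abs_mul, abs_of_nonneg hGy0]; gcongr)).1
      exact this
    have hgain : δ * Real.exp (-(lam * T)) * A.indicator (fun _ => (1 : ℝ)) s ≤
        (revenueRate F (z s) - revenueRate F (y s)) * Pz := by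
      by_cases hsA : s ∈ A
      · rw [hz, piecewise_eq_of_mem _ _ _ hsA, indicator_of_mem hsA, mul_one]
        have := hδ s hsA
        gcongr
        · linarith
        · linarith
      · simp [hz, hsA]
    linarith
  have hint := intervalIntegral.integral_mono_on htT
    ((intervalIntegrable_revenueRate_mul hlam hF hFm hM htT hy
      (continuous_poissonLT (N + 1))).add
      (((hind.const_mul (δ * Real.exp (-(lam * T)))).intervalIntegrable).sub
        intervalIntegrable_const))
    (intervalIntegrable_revenueRate_mul hlam hF hFm hM htT hza (continuous_poissonLT (N + 1))) hpt
  rw [intervalIntegral.integral_add (intervalIntegrable_revenueRate_mul hlam hF hFm hM htT hy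
      (continuous_poissonLT (N + 1))) (((hind.const_mul _).intervalIntegrable).sub
        intervalIntegrable_const), intervalIntegral.integral_sub
      (hind.const_mul _).intervalIntegrable intervalIntegrable_const,
    intervalIntegral.integral_const_mul, intervalIntegral.integral_const] at hint
  have hindT : ∫ s in t..T, A.indicator (fun _ => (1 : ℝ)) s = volume.real A := by
    rw [intervalIntegral.integral_of_le htT, ← integral_Icc_eq_integral_Ioc,
      setIntegral_indicator hA, inter_eq_self_of_subset_right hAT]
    simp
  rw [hindT, smul_eq_mul] at hint
  rw [revenue_eq q κ hlam hF hFm hM htT hy, revenue_eq q κ hlam hF hFm hM htT hza]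
  have hV : 0 ≤ volume.real A := measureReal_nonneg
  have hbnd : (T - t) * (M * η * lam * volume.real A) ≤ T * (M * η * lam * volume.real A) := by
    gcongr; linarith
  have hkey := mul_le_mul_of_nonneg_left (show
    (∫ s in t..T, revenueRate F (y s) * poissonLT (N + 1) (cumIntensity lam F y t s)) +
      volume.real A * (δ * Real.exp (-(lam * T)) - M * η * lam * T) ≤
    ∫ s in t..T, revenueRate F (z s) * poissonLT (N + 1) (cumIntensity lam F z t s) by
      linarith) (mul_nonneg hq hlam)
  linarith

/-- A constant threshold that maximizes the revenue rate is optimal up to an error that vanishes as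
the number of machines grows. -/
lemma revenue_le_revenue_const_add {q κ c : ℝ} {N : ℕ} (hlam : 0 ≤ lam) (hq : 0 ≤ q)
    (hF : ∀ x, F x ∈ Icc (0 : ℝ) 1) (hFm : Measurable F) (hc : 0 ≤ c)
    (hM : ∀ x, 0 ≤ x → revenueRate F x ≤ revenueRate F c) (ht : 0 ≤ t) (htT : t ≤ T)
    (hy : Admissible t T y) :
    revenue lam q κ T F (N + 1) t y ≤ revenue lam q κ T F (N + 1) t (fun _ => c) +
      q * lam * (T * (revenueRate F c * ((lam * T) ^ N / (N.factorial : ℝ) * (lam * T)))) := by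
  have hT : 0 ≤ T := ht.trans htT
  set η := (lam * T) ^ N / (N.factorial : ℝ) with hη
  have hη0 : 0 ≤ η := by positivity
  have hM0 : 0 ≤ revenueRate F c := by simpa [revenueRate] using hM 0 le_rfl
  have hca : Admissible t T (fun _ => c) := ⟨measurable_const, fun _ _ => hc⟩
  have hpt : ∀ s ∈ Icc t T,
      revenueRate F (y s) * poissonLT (N + 1) (cumIntensity lam F y t s) ≤
      revenueRate F c * poissonLT (N + 1) (cumIntensity lam F (fun _ => c) t s) +
        revenueRate F c * (η * (lam * T)) := by
    intro s hs
    have hHy := cumIntensity_mem_Icc hlam hF ht hs.1 hs.2 y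
    have hHc := cumIntensity_mem_Icc hlam hF ht hs.1 hs.2 (fun _ => c)
    -- Comparing with mean `0`, where the probability is `1`, shows that the constant threshold
    -- almost never runs out of machines.
    have hL := abs_poissonLT_sub_le N (left_mem_Icc.2 (by positivity : 0 ≤ lam * T)) hHc
    rw [poissonLT_succ_zero, sub_zero, abs_of_nonneg hHc.1] at hL
    have h1 : 1 ≤ poissonLT (N + 1) (cumIntensity lam F (fun _ => c) t s) + η * (lam * T) := by
      have := mul_le_mul_of_nonneg_left hHc.2 hη0
      linarith [(abs_le.1 hL).1]
    have hGyM := hM _ (hy.2 s hs)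
    calc _ ≤ revenueRate F c * 1 :=
          mul_le_mul hGyM (poissonLT_le_one _ hHy.1) (poissonLT_nonneg _ hHy.1) hM0
      _ ≤ _ := by rw [← mul_add]; gcongr
  have hIc := intervalIntegrable_revenueRate_mul (lam := lam) hlam hF hFm hM htT hca
    (continuous_poissonLT (N + 1))
  have hint := intervalIntegral.integral_mono_on htT
    (intervalIntegrable_revenueRate_mul hlam hF hFm hM htT hy (continuous_poissonLT (N + 1)))
    (hIc.add intervalIntegrable_const) hpt
  rw [intervalIntegral.integral_add hIc intervalIntegrable_const,
    intervalIntegral.integral_const, smul_eq_mul] at hint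
  rw [revenue_eq q κ hlam hF hFm hM htT hy, revenue_eq q κ hlam hF hFm hM htT hca]
  have hbnd : (T - t) * (revenueRate F c * (η * (lam * T))) ≤
      T * (revenueRate F c * (η * (lam * T))) := by
    gcongr; linarith
  have hkey := mul_le_mul_of_nonneg_left (hint.trans (add_le_add_right hbnd _))
    (mul_nonneg hq hlam)
  linarith

end Thresholds

/-! ### The revenue rate of a distribution with a density -/

section Distribution

variable {μ : Measure ℝ} {f : ℝ → ℝ}

lemma cdf_mem_Icc (μ : Measure ℝ) (x : ℝ) : cdf μ x ∈ Icc (0 : ℝ) 1 :=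
  ⟨cdf_nonneg μ x, cdf_le_one μ x⟩

lemma isOpen_supportInterior {F : ℝ → ℝ} (hF : Continuous F) : IsOpen (supportInterior F) :=
  (isOpen_lt continuous_const hF).inter (isOpen_lt hF continuous_const)

lemma pos_of_mem_supportInterior (h0 : cdf μ 0 = 0) {x : ℝ} (hx : x ∈ supportInterior (cdf μ)) :
    0 < x := by
  by_contra! h
  have := monotone_cdf μ h
  linarith [hx.1]

lemma continuous_revenueRate {F : ℝ → ℝ} (hF : Continuous F) : Continuous (revenueRate F) :=
  continuous_id.mul (continuous_const.sub hF)

lemma revenueRate_pos (h0 : cdf μ 0 = 0) {x : ℝ} (hx : x ∈ supportInterior (cdf μ)) :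
    0 < revenueRate (cdf μ) x :=
  mul_pos (pos_of_mem_supportInterior h0 hx) (by linarith [hx.2])

lemma virtualValuation_eq_zero {F : ℝ → ℝ} {c : ℝ} (hc : IsMyersonThreshold F f c) :
    virtualValuation F f c = 0 := sub_eq_zero.2 hc.2

lemma exists_mem_supportInterior_gt (hcont : Continuous (cdf μ)) {c ε : ℝ}
    (hc : c ∈ supportInterior (cdf μ)) (hε : 0 < ε) :
    ∃ b ∈ supportInterior (cdf μ), c < b ∧ b < c + ε := by
  have h : ∀ᶠ b in 𝓝[>] c, b ∈ supportInterior (cdf μ) :=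
    nhdsWithin_le_nhds ((isOpen_supportInterior hcont).mem_nhds hc)
  obtain ⟨b, hb, hbI⟩ := (h.and (Ioo_mem_nhdsGT (show c < c + ε by linarith))).exists
  exact ⟨b, hb, hbI⟩

variable [IsProbabilityMeasure μ]

lemma integrable_density (hfm : Measurable f) (hf0 : ∀ x, 0 ≤ f x)
    (hpdf : μ = volume.withDensity (fun x => ENNReal.ofReal (f x))) : Integrable f := by
  refine ⟨hfm.aestronglyMeasurable, ?_⟩
  rw [hasFiniteIntegral_iff_ofReal (Eventually.of_forall hf0)]
  have h : μ univ = ∫⁻ x, ENNReal.ofReal (f x) := by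
    rw [hpdf, withDensity_apply _ MeasurableSet.univ, Measure.restrict_univ]
  rw [← h]
  exact measure_lt_top μ univ

lemma cdf_eq_setIntegral (hfm : Measurable f) (hf0 : ∀ x, 0 ≤ f x)
    (hpdf : μ = volume.withDensity (fun x => ENNReal.ofReal (f x))) (x : ℝ) :
    cdf μ x = ∫ u in Iic x, f u := by
  rw [cdf_eq_real, measureReal_def, integral_eq_lintegral_of_nonneg_ae
    (Eventually.of_forall hf0) hfm.aestronglyMeasurable]
  conv_lhs => rw [hpdf]
  rw [withDensity_apply _ measurableSet_Iic]

lemma cdf_eq_add_intervalIntegral (hfm : Measurable f) (hf0 : ∀ x, 0 ≤ f x)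
    (hpdf : μ = volume.withDensity (fun x => ENNReal.ofReal (f x))) (a x : ℝ) :
    cdf μ x = cdf μ a + ∫ u in a..x, f u := by
  have hi := integrable_density hfm hf0 hpdf
  rw [cdf_eq_setIntegral hfm hf0 hpdf, cdf_eq_setIntegral hfm hf0 hpdf,
    ← intervalIntegral.integral_Iic_sub_Iic hi.integrableOn hi.integrableOn]
  ring

lemma continuous_cdf (hfm : Measurable f) (hf0 : ∀ x, 0 ≤ f x)
    (hpdf : μ = volume.withDensity (fun x => ENNReal.ofReal (f x))) : Continuous (cdf μ) := by
  have hi := integrable_density hfm hf0 hpdf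
  rw [show (cdf μ : ℝ → ℝ) = fun x => cdf μ 0 + ∫ u in (0 : ℝ)..x, f u from
    funext (cdf_eq_add_intervalIntegral hfm hf0 hpdf 0)]
  exact continuous_const.add
    (intervalIntegral.continuous_primitive (fun _ _ => hi.intervalIntegrable) 0)

lemma hasDerivAt_cdf (hfm : Measurable f) (hf0 : ∀ x, 0 ≤ f x)
    (hpdf : μ = volume.withDensity (fun x => ENNReal.ofReal (f x)))
    (hfc : ContinuousOn f (supportInterior (cdf μ))) {x : ℝ} (hx : x ∈ supportInterior (cdf μ)) :
    HasDerivAt (cdf μ) (f x) x := by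
  have hi := integrable_density hfm hf0 hpdf
  have hcont : ContinuousAt f x :=
    hfc.continuousAt ((isOpen_supportInterior (continuous_cdf hfm hf0 hpdf)).mem_nhds hx)
  rw [show (cdf μ : ℝ → ℝ) = fun x => cdf μ 0 + ∫ u in (0 : ℝ)..x, f u from
    funext (cdf_eq_add_intervalIntegral hfm hf0 hpdf 0)]
  exact (intervalIntegral.integral_hasDerivAt_right hi.intervalIntegrable
    hfm.stronglyMeasurable.stronglyMeasurableAtFilter hcont).const_add _

/-- The law charges no negative number, and continuity of the distribution function excludes an atom
at `0`. -/
lemma cdf_zero_eq_zero (hfm : Measurable f) (hf0 : ∀ x, 0 ≤ f x)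
    (hpdf : μ = volume.withDensity (fun x => ENNReal.ofReal (f x))) (hμ : μ (Iio 0) = 0) :
    cdf μ 0 = 0 := by
  have hneg : ∀ x < 0, cdf μ x = 0 := fun x hx => by
    rw [cdf_eq_real, measureReal_def,
      measure_mono_null (show Iic x ⊆ Iio 0 from fun u hu => lt_of_le_of_lt hu hx) hμ]
    rfl
  have h1 : Tendsto (cdf μ) (𝓝[<] 0) (𝓝 (cdf μ 0)) :=
    (continuous_cdf hfm hf0 hpdf).continuousWithinAt
  have h2 : Tendsto (cdf μ) (𝓝[<] 0) (𝓝 0) :=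
    tendsto_const_nhds.congr' (by
      filter_upwards [self_mem_nhdsWithin] with x hx using (hneg x hx).symm)
  exact tendsto_nhds_unique h1 h2

lemma hasDerivAt_revenueRate (hfm : Measurable f) (hf0 : ∀ x, 0 ≤ f x)
    (hpdf : μ = volume.withDensity (fun x => ENNReal.ofReal (f x)))
    (hfc : ContinuousOn f (supportInterior (cdf μ)))
    (hfpos : ∀ x ∈ supportInterior (cdf μ), 0 < f x)
    {x : ℝ} (hx : x ∈ supportInterior (cdf μ)) :
    HasDerivAt (revenueRate (cdf μ)) (-(f x * virtualValuation (cdf μ) f x)) x := by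
  have h := (hasDerivAt_id x).mul ((hasDerivAt_cdf hfm hf0 hpdf hfc hx).const_sub 1)
  refine h.congr_deriv ?_
  have := (hfpos x hx).ne'
  simp only [virtualValuation, id]
  field_simp
  ring

/-- Markov's inequality on the tail: `n P(X > n) ≤ E[X; X > n]`, which vanishes by integrability. -/
lemma tendsto_revenueRate_natCast (hX : Integrable (fun x => x) μ) :
    Tendsto (fun n : ℕ => revenueRate (cdf μ) n) atTop (𝓝 0) := by
  have hint : Tendsto (fun n : ℕ => ∫ u in Ioi (n : ℝ), u ∂μ) atTop (𝓝 0) := by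
    have h := tendsto_setIntegral_of_antitone (μ := μ) (f := fun u : ℝ => u)
      (s := fun n : ℕ => Ioi (n : ℝ)) (fun _ => measurableSet_Ioi)
      (fun m n hmn => Ioi_subset_Ioi (by exact_mod_cast hmn)) ⟨0, hX.integrableOn⟩
    have he : ⋂ n : ℕ, Ioi (n : ℝ) = ∅ := by
      refine eq_empty_of_forall_notMem fun x hx => ?_
      obtain ⟨n, hn⟩ := exists_nat_ge x
      exact absurd (mem_iInter.1 hx n) (not_lt.2 hn)
    simpa [he] using h
  refine squeeze_zero (fun n => mul_nonneg n.cast_nonneg (by linarith [cdf_le_one μ n]))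
    (fun n => ?_) hint
  have hm : 1 - cdf μ n = μ.real (Ioi (n : ℝ)) := by
    rw [cdf_eq_real, ← compl_Iic, probReal_compl_eq_one_sub measurableSet_Iic]
  calc revenueRate (cdf μ) n = ∫ _ in Ioi (n : ℝ), (n : ℝ) ∂μ := by
        rw [setIntegral_const, smul_eq_mul, revenueRate, hm, mul_comm]
    _ ≤ _ := setIntegral_mono_on integrableOn_const hX.integrableOn measurableSet_Ioi
        fun u hu => le_of_lt hu

/-- `G` is positive at a median and eventually smaller than there, so it has an interior maximum on
some `[0, n]`, where `G' = -fψ` vanishes. Positivity of `F` on `(0, ∞)` places the maximizer in the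
support, where `G` is differentiable. -/
lemma exists_isMyersonThreshold (hfm : Measurable f) (hf0 : ∀ x, 0 ≤ f x)
    (hpdf : μ = volume.withDensity (fun x => ENNReal.ofReal (f x))) (hμ : μ (Iio 0) = 0)
    (hfc : ContinuousOn f (supportInterior (cdf μ)))
    (hfpos : ∀ x ∈ supportInterior (cdf μ), 0 < f x)
    (hpos : ∀ x > 0, 0 < cdf μ x) (hX : Integrable (fun x => x) μ) :
    ∃ c, IsMyersonThreshold (cdf μ) f c := by
  have hcont := continuous_cdf hfm hf0 hpdf
  have h0 := cdf_zero_eq_zero hfm hf0 hpdf hμ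
  obtain ⟨x₀, hx₀⟩ : ∃ x, cdf μ x = 1 / 2 := by
    refine mem_range_of_exists_le_of_exists_ge hcont ⟨0, by rw [h0]; norm_num⟩ ?_
    exact (((tendsto_cdf_atTop μ).eventually_const_le (by norm_num : (1 / 2 : ℝ) < 1))).exists
  have hx₀D : x₀ ∈ supportInterior (cdf μ) := by
    constructor <;> rw [hx₀] <;> norm_num
  have hG₀ := revenueRate_pos h0 hx₀D
  obtain ⟨n, hn, hxn⟩ := (((tendsto_revenueRate_natCast hX).eventually_lt_const hG₀).and
    (tendsto_natCast_atTop_atTop.eventually_ge_atTop x₀)).exists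
  have hx₀I : x₀ ∈ Icc (0 : ℝ) n := ⟨(pos_of_mem_supportInterior h0 hx₀D).le, hxn⟩
  obtain ⟨c, hcI, hc⟩ := isCompact_Icc.exists_isMaxOn ⟨x₀, hx₀I⟩
    (continuous_revenueRate hcont).continuousOn
  have hGc : 0 < revenueRate (cdf μ) c := hG₀.trans_le (hc hx₀I)
  have hc0 : 0 < c := hcI.1.lt_of_ne fun h => by
    rw [← h] at hGc; simp [revenueRate] at hGc
  have hcn : c < n := hcI.2.lt_of_ne fun h => by
    rw [← h] at hn; exact absurd (hc hx₀I) (not_le.2 hn)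
  have hcD : c ∈ supportInterior (cdf μ) :=
    ⟨hpos c hc0, by linarith [(mul_pos_iff_of_pos_left hc0).1 hGc]⟩
  have hd := (hc.isLocalMax (Icc_mem_nhds hc0 hcn)).hasDerivAt_eq_zero
    (hasDerivAt_revenueRate hfm hf0 hpdf hfc hfpos hcD)
  refine ⟨c, hcD, ?_⟩
  rw [neg_eq_zero, mul_eq_zero] at hd
  exact sub_eq_zero.1 (hd.resolve_left (hfpos c hcD).ne')

lemma strictMonoOn_revenueRate (hfm : Measurable f) (hf0 : ∀ x, 0 ≤ f x)
    (hpdf : μ = volume.withDensity (fun x => ENNReal.ofReal (f x))) (hμ : μ (Iio 0) = 0)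
    (hfc : ContinuousOn f (supportInterior (cdf μ)))
    (hfpos : ∀ x ∈ supportInterior (cdf μ), 0 < f x)
    (hvv : StrictMonoOn (virtualValuation (cdf μ) f) (supportInterior (cdf μ)))
    {c : ℝ} (hc : IsMyersonThreshold (cdf μ) f c) :
    StrictMonoOn (revenueRate (cdf μ)) (Iic c) := by
  have hcont := continuous_cdf hfm hf0 hpdf
  have h0 := cdf_zero_eq_zero hfm hf0 hpdf hμ
  have hc0 := pos_of_mem_supportInterior h0 hc.1
  -- `a` is the last zero of `F` before `c`: up to `a` the rate `G` is the identity, and beyond it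
  -- the sign of `ψ` decides.
  obtain ⟨a, ⟨haI, ha⟩, hamax⟩ :=
    (isCompact_Icc.inter_right (isClosed_eq hcont continuous_const)).exists_isGreatest
      (s := Icc 0 c ∩ {x | cdf μ x = 0}) ⟨0, ⟨le_rfl, hc0.le⟩, h0⟩
  have hpos : ∀ x ∈ Ioc a c, 0 < cdf μ x := fun x hx =>
    (cdf_nonneg μ x).lt_of_ne' fun h =>
      absurd (hamax ⟨⟨haI.1.trans hx.1.le, hx.2⟩, h⟩) (not_le.2 hx.1)
  rw [← Iic_union_Icc_eq_Iic haI.2]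
  refine StrictMonoOn.union (c := a) ?_ ?_ isGreatest_Iic (isLeast_Icc haI.2)
  · have hid : ∀ x ∈ Iic a, revenueRate (cdf μ) x = x := fun x hx => by
      have : cdf μ x = 0 := le_antisymm ((monotone_cdf μ hx).trans_eq ha) (cdf_nonneg μ x)
      simp [revenueRate, this]
    intro x hx x' hx' hlt
    rwa [hid x hx, hid x' hx']
  · refine strictMonoOn_of_deriv_pos (convex_Icc a c) (continuous_revenueRate hcont).continuousOn
      fun x hx => ?_
    rw [interior_Icc] at hx
    have hxD : x ∈ supportInterior (cdf μ) :=
      ⟨hpos x ⟨hx.1, hx.2.le⟩, (monotone_cdf μ hx.2.le).trans_lt hc.1.2⟩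
    rw [(hasDerivAt_revenueRate hfm hf0 hpdf hfc hfpos hxD).deriv]
    have h1 := hvv hxD hc.1 hx.2
    rw [virtualValuation_eq_zero hc] at h1
    have h2 := hfpos x hxD
    nlinarith

lemma strictAntiOn_revenueRate (hfm : Measurable f) (hf0 : ∀ x, 0 ≤ f x)
    (hpdf : μ = volume.withDensity (fun x => ENNReal.ofReal (f x)))
    (hfc : ContinuousOn f (supportInterior (cdf μ)))
    (hfpos : ∀ x ∈ supportInterior (cdf μ), 0 < f x)
    (hvv : StrictMonoOn (virtualValuation (cdf μ) f) (supportInterior (cdf μ)))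
    {c b : ℝ} (hc : IsMyersonThreshold (cdf μ) f c) (hb : cdf μ b < 1) :
    StrictAntiOn (revenueRate (cdf μ)) (Icc c b) := by
  have hcont := continuous_cdf hfm hf0 hpdf
  refine strictAntiOn_of_deriv_neg (convex_Icc c b) (continuous_revenueRate hcont).continuousOn
    fun x hx => ?_
  rw [interior_Icc] at hx
  have hxD : x ∈ supportInterior (cdf μ) :=
    ⟨hc.1.1.trans_le (monotone_cdf μ hx.1.le), (monotone_cdf μ hx.2.le).trans_lt hb⟩
  rw [(hasDerivAt_revenueRate hfm hf0 hpdf hfc hfpos hxD).deriv]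
  have h1 := hvv hc.1 hxD hx.1
  rw [virtualValuation_eq_zero hc] at h1
  have h2 := hfpos x hxD
  nlinarith

/-- The Myerson threshold is the well-separated maximizer of the revenue rate. -/
lemma exists_revenueRate_gap (hfm : Measurable f) (hf0 : ∀ x, 0 ≤ f x)
    (hpdf : μ = volume.withDensity (fun x => ENNReal.ofReal (f x))) (hμ : μ (Iio 0) = 0)
    (hfc : ContinuousOn f (supportInterior (cdf μ)))
    (hfpos : ∀ x ∈ supportInterior (cdf μ), 0 < f x)
    (hvv : StrictMonoOn (virtualValuation (cdf μ) f) (supportInterior (cdf μ)))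
    {c : ℝ} (hc : IsMyersonThreshold (cdf μ) f c) {ε : ℝ} (hε : 0 < ε) :
    ∃ δ > 0, ∀ x, ε ≤ |x - c| → revenueRate (cdf μ) x + δ ≤ revenueRate (cdf μ) c := by
  have hcont := continuous_cdf hfm hf0 hpdf
  have h0 := cdf_zero_eq_zero hfm hf0 hpdf hμ
  have hmono := strictMonoOn_revenueRate hfm hf0 hpdf hμ hfc hfpos hvv hc
  -- Since `c + ε` may lie beyond the support, a nearer point `b` inside it is used. There `G(b) >
  -- 0`, which also dominates points with `F = 1`, where `G = 0`.
  obtain ⟨b, hbD, hcb, hbε⟩ := exists_mem_supportInterior_gt hcont hc.1 hε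
  have hl : revenueRate (cdf μ) (c - ε) < revenueRate (cdf μ) c :=
    hmono (show c - ε ≤ c by linarith) (show c ≤ c from le_rfl) (by linarith)
  have hr : revenueRate (cdf μ) b < revenueRate (cdf μ) c :=
    strictAntiOn_revenueRate hfm hf0 hpdf hfc hfpos hvv hc hbD.2
      ⟨le_rfl, hcb.le⟩ ⟨hcb.le, le_rfl⟩ hcb
  refine ⟨min (revenueRate (cdf μ) c - revenueRate (cdf μ) (c - ε))
    (revenueRate (cdf μ) c - revenueRate (cdf μ) b),
    lt_min (by linarith) (by linarith), fun x hx => ?_⟩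
  rcases le_abs'.1 hx with hx | hx
  · have : revenueRate (cdf μ) x ≤ revenueRate (cdf μ) (c - ε) :=
      hmono.monotoneOn (show x ≤ c by linarith) (show c - ε ≤ c by linarith) (by linarith)
    linarith [min_le_left (revenueRate (cdf μ) c - revenueRate (cdf μ) (c - ε))
      (revenueRate (cdf μ) c - revenueRate (cdf μ) b)]
  · have : revenueRate (cdf μ) x ≤ revenueRate (cdf μ) b := by
      rcases (cdf_le_one μ x).lt_or_eq with hx1 | hx1
      · exact (strictAntiOn_revenueRate hfm hf0 hpdf hfc hfpos hvv hc hx1).antitoneOn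
          ⟨hcb.le, by linarith⟩ ⟨by linarith, le_rfl⟩ (by linarith)
      · have : revenueRate (cdf μ) x = 0 := by simp [revenueRate, hx1]
        rw [this]
        exact (revenueRate_pos h0 hbD).le
    linarith [min_le_right (revenueRate (cdf μ) c - revenueRate (cdf μ) (c - ε))
      (revenueRate (cdf μ) c - revenueRate (cdf μ) b)]

lemma revenueRate_le_of_isMyersonThreshold (hfm : Measurable f) (hf0 : ∀ x, 0 ≤ f x)
    (hpdf : μ = volume.withDensity (fun x => ENNReal.ofReal (f x))) (hμ : μ (Iio 0) = 0)
    (hfc : ContinuousOn f (supportInterior (cdf μ)))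
    (hfpos : ∀ x ∈ supportInterior (cdf μ), 0 < f x)
    (hvv : StrictMonoOn (virtualValuation (cdf μ) f) (supportInterior (cdf μ)))
    {c : ℝ} (hc : IsMyersonThreshold (cdf μ) f c) (x : ℝ) :
    revenueRate (cdf μ) x ≤ revenueRate (cdf μ) c := by
  rcases eq_or_ne x c with rfl | hx
  · exact le_rfl
  · obtain ⟨δ, hδ, h⟩ := exists_revenueRate_gap hfm hf0 hpdf hμ hfc hfpos hvv hc
      (abs_pos.2 (sub_ne_zero.2 hx))
    linarith [h x le_rfl]

end Distribution

/-! ### Limits as the number of machines grows -/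

lemma eventually_mul_pow_div_factorial_lt (C L : ℝ) {ε : ℝ} (hε : 0 < ε) :
    ∀ᶠ N : ℕ in atTop, C * (L ^ N / (N.factorial : ℝ)) < ε := by
  have h := (FloorSemiring.tendsto_pow_div_factorial_atTop L).const_mul C
  rw [mul_zero] at h
  exact h.eventually_lt_const hε

lemma eventually_atTop_of_succ {p : ℕ → Prop} (h : ∀ᶠ N in atTop, p (N + 1)) :
    ∀ᶠ N in atTop, p N := by
  obtain ⟨N₀, hN₀⟩ := eventually_atTop.1 h
  refine eventually_atTop.2 ⟨N₀ + 1, fun N hN => ?_⟩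
  have := hN₀ (N - 1) (by omega)
  rwa [Nat.sub_add_cancel (by omega)] at this

/-- A violation inside the interval would persist on a neighbourhood, which has positive measure.
The endpoints follow by closure, as `t < T`. -/
lemma forall_le_of_ae_le_of_continuousOn {g : ℝ → ℝ} {t T C : ℝ} (htT : t < T)
    (hg : ContinuousOn g (Icc t T)) (h : ∀ᵐ s ∂(volume.restrict (Icc t T)), g s ≤ C) :
    ∀ s ∈ Icc t T, g s ≤ C := by
  have hsub : Ioo t T ⊆ {s | g s ≤ C} := by
    intro s hs
    by_contra hlt
    have hlt : C < g s := not_le.1 hlt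
    have hca : ContinuousAt g s := hg.continuousAt (Icc_mem_nhds hs.1 hs.2)
    have hnhds : {u | C < g u} ∩ Icc t T ∈ 𝓝 s :=
      inter_mem (hca.eventually_const_lt hlt) (Icc_mem_nhds hs.1 hs.2)
    refine (Measure.measure_pos_of_mem_nhds volume hnhds).ne' ?_
    rw [ae_restrict_iff' measurableSet_Icc] at h
    refine measure_mono_null (fun u hu => ?_) (ae_iff.1 h)
    exact fun hle => absurd (hle hu.2) (not_le.2 hu.1)
  intro s hs
  have hcl : s ∈ closure (Ioo t T) := by rwa [closure_Ioo htT.ne]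
  have : (𝓝[Ioo t T] s).NeBot := mem_closure_iff_nhdsWithin_neBot.1 hcl
  exact le_of_tendsto ((hg s hs).mono Ioo_subset_Icc_self)
    (by filter_upwards [self_mem_nhdsWithin] with u hu using hsub hu)

section Limits

variable {lam T q κ : ℝ} {μ : Measure ℝ} {f : ℝ → ℝ}

lemma eventually_kernelJ_lt (hlam : 0 < lam) {ε : ℝ} (hε : 0 < ε) :
    ∀ᶠ N : ℕ in atTop, ∀ t s : ℝ, 0 ≤ t → t ≤ s → s ≤ T →
      ∀ y : ℝ → ℝ, |kernelJ lam (cdf μ) y N t s| < ε := by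
  refine eventually_atTop_of_succ ?_
  filter_upwards [eventually_mul_pow_div_factorial_lt 1 (lam * T) hε] with N hN t s ht hts hs y
  have h := kernelJ_succ_mem_Icc hlam.le (cdf_mem_Icc μ) ht hts hs y N
  rw [abs_of_nonneg h.1]
  linarith [h.2]

/-- Gain and loss of the reset are both proportional to `|A|`, so `N` can be chosen before `t`, `y`
and `A`. -/
lemma eventually_ae_abs_sub_lt (hlam : 0 < lam) (hq : 0 < q) {c : ℝ} (hc : 0 ≤ c)
    (hM : ∀ x, revenueRate (cdf μ) x ≤ revenueRate (cdf μ) c) {ε δ : ℝ} (hδ : 0 < δ)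
    (hgap : ∀ x, ε ≤ |x - c| → revenueRate (cdf μ) x + δ ≤ revenueRate (cdf μ) c) :
    ∀ᶠ N : ℕ in atTop, ∀ t : ℝ, 0 ≤ t → t < T →
      ∀ y, IsOptimalThreshold lam q κ T (cdf μ) N t y →
        ∀ᵐ s ∂(volume.restrict (Icc t T)), |y s - c| < ε := by
  classical
  refine eventually_atTop_of_succ ?_
  have hE : 0 < δ * Real.exp (-(lam * T)) := by positivity
  filter_upwards [eventually_mul_pow_div_factorial_lt (revenueRate (cdf μ) c * lam * T) (lam * T)
    hE] with N hN t ht htT y hy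
  set A : Set ℝ := Icc t T ∩ {s | ε ≤ |y s - c|} with hAdef
  have hA : MeasurableSet A :=
    measurableSet_Icc.inter (measurableSet_le measurable_const
      (continuous_abs.measurable.comp (hy.1.1.sub_const c)))
  have hgain := revenue_piecewise_gain (κ := κ) (N := N) hlam.le hq.le (cdf_mem_Icc μ)
    (monotone_cdf μ).measurable (fun x _ => hM x) ht htT.le hy.1 hc hA inter_subset_left hδ.le
    (fun s hs => hgap _ hs.2)
  have hza : Admissible t T (A.piecewise (fun _ => c) y) := by
    refine ⟨Measurable.piecewise hA measurable_const hy.1.1, fun s hs => ?_⟩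
    by_cases hsA : s ∈ A
    · rwa [piecewise_eq_of_mem _ _ _ hsA]
    · rw [piecewise_eq_of_notMem _ _ _ hsA]; exact hy.1.2 s hs
  have hopt := hy.2 _ hza
  have hAfin : volume A ≠ ⊤ := ((measure_mono inter_subset_left).trans_lt (by simp)).ne
  have hA0 : volume A = 0 := by
    by_contra hne
    have hV : 0 < volume.real A := ENNReal.toReal_pos hne hAfin
    have : 0 < q * lam * (volume.real A * (δ * Real.exp (-(lam * T)) -
        revenueRate (cdf μ) c * ((lam * T) ^ N / (N.factorial : ℝ)) * lam * T)) :=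
      mul_pos (mul_pos hq hlam) (mul_pos hV (by linarith))
    linarith
  rw [ae_restrict_iff' measurableSet_Icc, ae_iff]
  refine measure_mono_null (fun s hs => ?_) hA0
  simp only [mem_ofPred_eq, Classical.not_imp, not_lt] at hs
  exact hs

/-- The equation expresses `ψ(y(t))` as a nonnegative integral of order `η`; once this is below
`ψ(b)`, monotonicity gives `c ≤ y(t) < b < c + ε`. -/
lemma eventually_abs_sub_lt_of_solvesThresholdEquation (hlam : 0 < lam) (hT : 0 < T)
    (hcont : Continuous (cdf μ)) (h0 : cdf μ 0 = 0)
    (hfpos : ∀ x ∈ supportInterior (cdf μ), 0 < f x)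
    (hvv : StrictMonoOn (virtualValuation (cdf μ) f) (supportInterior (cdf μ)))
    {c : ℝ} (hc : IsMyersonThreshold (cdf μ) f c)
    (hM : ∀ x, revenueRate (cdf μ) x ≤ revenueRate (cdf μ) c) {ε : ℝ} (hε : 0 < ε) :
    ∀ᶠ N : ℕ in atTop, ∀ y, SolvesThresholdEquation lam T (cdf μ) f N y →
      ∀ t ∈ Icc 0 T, |y t - c| < ε := by
  obtain ⟨b, hbD, hcb, hbε⟩ := exists_mem_supportInterior_gt hcont hc.1 hε
  have hψb : 0 < virtualValuation (cdf μ) f b := by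
    have := hvv hc.1 hbD hcb
    rwa [virtualValuation_eq_zero hc] at this
  have hM0 := (revenueRate_pos h0 hc.1).le
  refine eventually_atTop_of_succ ?_
  filter_upwards [eventually_mul_pow_div_factorial_lt (lam * revenueRate (cdf μ) c * T) (lam * T)
    hψb] with N hN y ⟨_, hyD, hyeq⟩ t ht
  set η := (lam * T) ^ N / (N.factorial : ℝ) with hη
  have hη0 : 0 ≤ η := by positivity
  -- since virtual valuations are nonnegative along `y`, the weight `(1 - F)² / f` is dominated by the revenue rate
  have hweight0 : ∀ s ∈ Icc 0 T, 0 ≤ (1 - cdf μ (y s)) ^ 2 / f (y s) := fun s hs =>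
    div_nonneg (sq_nonneg _) (hfpos _ (hyD s hs)).le
  have hψ : ∀ s ∈ Icc 0 T, virtualValuation (cdf μ) f (y s) =
      lam * ∫ u in s..T, (1 - cdf μ (y u)) ^ 2 / f (y u) * kernelJ lam (cdf μ) y (N + 1) s u :=
    fun s hs => by
      have := hyeq s hs
      unfold virtualValuation
      linarith
  have hψ0 : ∀ s ∈ Icc 0 T, 0 ≤ virtualValuation (cdf μ) f (y s) := fun s hs => by
    rw [hψ s hs]
    refine mul_nonneg hlam.le (intervalIntegral.integral_nonneg hs.2 fun u hu => ?_)
    exact mul_nonneg (hweight0 u ⟨hs.1.trans hu.1, hu.2⟩)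
      (kernelJ_succ_mem_Icc hlam.le (cdf_mem_Icc μ) hs.1 hu.1 hu.2 y N).1
  have hweight : ∀ s ∈ Icc 0 T,
      (1 - cdf μ (y s)) ^ 2 / f (y s) ≤ revenueRate (cdf μ) c := fun s hs => by
    refine le_trans ?_ (hM (y s))
    have h1 := hψ0 s hs
    have h2 : 0 ≤ 1 - cdf μ (y s) := by linarith [cdf_le_one μ (y s)]
    -- By definition of `ψ`, `(1 - F)/f = y - ψ`, which is at most `y` because `ψ ≥ 0`.
    have h3 : (1 - cdf μ (y s)) ^ 2 / f (y s) =
        (y s - virtualValuation (cdf μ) f (y s)) * (1 - cdf μ (y s)) := by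
      unfold virtualValuation; ring
    rw [h3, revenueRate]
    gcongr
    linarith
  have hψlt : virtualValuation (cdf μ) f (y t) < virtualValuation (cdf μ) f b := by
    have hI := intervalIntegral.norm_integral_le_of_norm_le_const (a := t) (b := T)
      (f := fun u => (1 - cdf μ (y u)) ^ 2 / f (y u) * kernelJ lam (cdf μ) y (N + 1) t u)
      (C := revenueRate (cdf μ) c * η) fun u hu => by
        rw [uIoc_of_le ht.2] at hu
        have huI : u ∈ Icc 0 T := ⟨ht.1.trans hu.1.le, hu.2⟩
        have hJ := kernelJ_succ_mem_Icc hlam.le (cdf_mem_Icc μ) ht.1 hu.1.le hu.2 y N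
        rw [Real.norm_of_nonneg (mul_nonneg (hweight0 u huI) hJ.1)]
        exact mul_le_mul (hweight u huI) hJ.2 hJ.1 hM0
    rw [abs_of_nonneg (by linarith [ht.2])] at hI
    rw [hψ t ht]
    have hI' := (le_abs_self _).trans hI
    calc _ ≤ lam * (revenueRate (cdf μ) c * η * (T - t)) := by gcongr
      _ ≤ lam * (revenueRate (cdf μ) c * η * T) := by gcongr; linarith [ht.1]
      _ = lam * revenueRate (cdf μ) c * T * η := by ring
      _ < _ := hN
  have hyc : c ≤ y t := by
    rw [← hvv.le_iff_le hc.1 (hyD t ht), virtualValuation_eq_zero hc]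
    exact hψ0 t ht
  have hyb : y t < b := (hvv.lt_iff_lt (hyD t ht) hbD).1 hψlt
  rw [abs_of_nonneg (by linarith)]
  linarith

end Limits

end VMAlloc

end

theorem mainTheorem2
    (lam T q κ : ℝ) (hlam : 0 < lam) (hT : 0 < T) (hq : 0 < q)
    -- law of the complexity of a task, with density `f`
    (μ : Measure ℝ) [IsProbabilityMeasure μ] (f : ℝ → ℝ)
    (hfm : Measurable f) (hf0 : ∀ x, 0 ≤ f x)
    (hpdf : μ = volume.withDensity (fun x => ENNReal.ofReal (f x)))
    (hμ : μ (Iio 0) = 0)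
    (hfc : ContinuousOn f (VMAlloc.supportInterior (cdf μ)))
    (hfpos : ∀ x ∈ VMAlloc.supportInterior (cdf μ), 0 < f x)
    -- increasing virtual valuations
    (hvv : StrictMonoOn (VMAlloc.virtualValuation (cdf μ) f)
      (VMAlloc.supportInterior (cdf μ))) :
    -- the kernel tends to 0, uniformly in times and threshold functions
    (∀ ε > 0, ∀ᶠ N : ℕ in atTop, ∀ t s : ℝ, 0 ≤ t → t ≤ s → s ≤ T →
      ∀ y, VMAlloc.Admissible t T y → |VMAlloc.kernelJ lam (cdf μ) y N t s| < ε) ∧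
    -- existence of the constant solution
    ((∀ x > 0, 0 < cdf μ x) → Integrable (fun x => x) μ →
      ∃ c, VMAlloc.IsMyersonThreshold (cdf μ) f c) ∧
    (∀ c, VMAlloc.IsMyersonThreshold (cdf μ) f c →
      -- uniqueness of the constant solution
      (∀ c', VMAlloc.IsMyersonThreshold (cdf μ) f c' → c' = c) ∧
      -- revenue maximizing thresholds converge uniformly to the constant `c`
      (∀ ε > 0, ∀ᶠ N : ℕ in atTop, ∀ t : ℝ, 0 ≤ t → t < T →
        ∀ y, VMAlloc.IsOptimalThreshold lam q κ T (cdf μ) N t y →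
          (∀ᵐ s ∂(volume.restrict (Icc t T)), |y s - c| < ε) ∧
          (ContinuousOn y (Icc t T) → ∀ s ∈ Icc t T, |y s - c| < ε)) ∧
      -- so do the solutions of the threshold equation
      (∀ ε > 0, ∀ᶠ N : ℕ in atTop,
        ∀ y, VMAlloc.SolvesThresholdEquation lam T (cdf μ) f N y →
          ∀ t ∈ Icc 0 T, |y t - c| < ε) ∧
      -- the constant threshold `c` is optimal in the limit
      (∀ ε > 0, ∀ᶠ N : ℕ in atTop, ∀ t : ℝ, 0 ≤ t → t ≤ T →
        ∀ y, VMAlloc.Admissible t T y →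
          VMAlloc.revenue lam q κ T (cdf μ) N t y ≤
            VMAlloc.revenue lam q κ T (cdf μ) N t (fun _ => c) + ε) ∧
      -- the limiting rule allocates exactly to nonnegative virtual valuations
      (∀ x ∈ VMAlloc.supportInterior (cdf μ),
        (c ≤ x ↔ 0 ≤ VMAlloc.virtualValuation (cdf μ) f x)) ∧
      -- and the optimal allocation decision for a task `x ≠ c` is eventually that rule
      (∀ x ∈ VMAlloc.supportInterior (cdf μ), x ≠ c → ∀ᶠ N : ℕ in atTop,
        ∀ t : ℝ, 0 ≤ t → t < T →
        ∀ y, VMAlloc.IsOptimalThreshold lam q κ T (cdf μ) N t y →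
          ∀ᵐ s ∂(volume.restrict (Icc t T)),
            (y s ≤ x ↔ 0 ≤ VMAlloc.virtualValuation (cdf μ) f x))) := by
  have hcont := VMAlloc.continuous_cdf hfm hf0 hpdf
  have h0 := VMAlloc.cdf_zero_eq_zero hfm hf0 hpdf hμ
  refine ⟨fun ε hε => ?_, VMAlloc.exists_isMyersonThreshold hfm hf0 hpdf hμ hfc hfpos,
    fun c hc => ?_⟩
  · filter_upwards [VMAlloc.eventually_kernelJ_lt (T := T) (μ := μ) hlam hε]
      with N hN t s ht hts hs y _
    exact hN t s ht hts hs y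
  have hM := VMAlloc.revenueRate_le_of_isMyersonThreshold hfm hf0 hpdf hμ hfc hfpos hvv hc
  have hc0 := VMAlloc.pos_of_mem_supportInterior h0 hc.1
  have hψc := VMAlloc.virtualValuation_eq_zero hc
  have hsign : ∀ x ∈ VMAlloc.supportInterior (cdf μ),
      (c ≤ x ↔ 0 ≤ VMAlloc.virtualValuation (cdf μ) f x) := fun x hx => by
    rw [← hvv.le_iff_le hc.1 hx, hψc]
  have hae : ∀ ε > 0, ∀ᶠ N : ℕ in atTop, ∀ t : ℝ, 0 ≤ t → t < T →
      ∀ y, VMAlloc.IsOptimalThreshold lam q κ T (cdf μ) N t y →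
        ∀ᵐ s ∂(volume.restrict (Icc t T)), |y s - c| < ε := fun ε hε => by
    obtain ⟨δ, hδ, hgap⟩ :=
      VMAlloc.exists_revenueRate_gap hfm hf0 hpdf hμ hfc hfpos hvv hc hε
    exact VMAlloc.eventually_ae_abs_sub_lt hlam hq hc0.le hM hδ hgap
  refine ⟨fun c' hc' => hvv.injOn hc'.1 hc.1 ?_, fun ε hε => ?_, fun ε hε => ?_, fun ε hε => ?_,
    hsign, fun x hx hxc => ?_⟩
  · rw [hψc, VMAlloc.virtualValuation_eq_zero hc']
  -- Passing from almost every to every `s` preserves only a weak inequality, so half of `ε` is kept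
  -- in reserve.
  · filter_upwards [hae (ε / 2) (half_pos hε)] with N hN t ht htT y hy
    have hy2 := hN t ht htT y hy
    refine ⟨hy2.mono fun s hs => hs.trans (half_lt_self hε), fun hyc s hs => ?_⟩
    exact (VMAlloc.forall_le_of_ae_le_of_continuousOn htT (hyc.sub continuousOn_const).abs
      (hy2.mono fun s hs => hs.le) s hs).trans_lt (half_lt_self hε)
  · exact VMAlloc.eventually_abs_sub_lt_of_solvesThresholdEquation hlam hT hcont h0 hfpos hvv hc
      hM hε
  · refine VMAlloc.eventually_atTop_of_succ ?_
    filter_upwards [VMAlloc.eventually_mul_pow_div_factorial_lt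
      (q * lam * (T * (VMAlloc.revenueRate (cdf μ) c * (lam * T)))) (lam * T) hε]
      with N hN t ht htT y hy
    have := VMAlloc.revenue_le_revenue_const_add (κ := κ) (N := N) hlam.le hq.le
      (VMAlloc.cdf_mem_Icc μ) (monotone_cdf μ).measurable hc0.le (fun x _ => hM x) ht htT hy
    linarith
  -- A threshold closer to `c` than `x` is lies on the same side of `x` as `c`.
  · filter_upwards [hae |x - c| (abs_pos.2 (sub_ne_zero.2 hxc))] with N hN t ht htT y hy
    filter_upwards [hN t ht htT y hy] with s hs
    rw [← hsign x hx]
    rcases lt_or_gt_of_ne hxc with h | h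
    · rw [abs_of_neg (sub_neg.2 h), abs_lt] at hs
      exact ⟨fun hle => by linarith [hs.1], fun hle => absurd hle (not_le.2 h)⟩
    · rw [abs_of_pos (sub_pos.2 h), abs_lt] at hs
      exact ⟨fun _ => h.le, fun _ => by linarith [hs.2]⟩
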